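/- Let $\mathcal{A}=(\mathcal{P},\mathcal{L})$ be a Desargues affine plane: two distinct points lie on exactly one line; through a point off a line $\ell$ there is exactly one line disjoint from $\ell$; there are three non-collinear points; and Desargues' axiom holds, i.e. if $AA'$, $BB'$, $CC'$ are three distinct lines that are parallel or have a common point, and $AB$, $A'B'$ are distinct parallel lines and $BC$, $B'C'$ are distinct parallel lines, with $A\neq C$ and $A'\neq C'$, then $AC\parallel A'C'$ (parallel means equal or disjoint). Fix two distinct points $O,I$ and let $\ell^{OI}$ be the line through them. For $A,B\in\ell^{OI}$ choose an auxiliary point $B_1\notin\ell^{OI}$. - The sum $A+B$ is the point of $\ell^{OI}$ on the parallel to $BB_1$ through $P_1$, where $P_1$ is the intersection of the parallel to $OI$ through $B_1$ with the parallel to $OB_1$ through $A$. - The product $A\cdot B$ is the point of $\ell^{OI}$ on the parallel to $BB_1$ through $P_1$, where $P_1$ is the intersection of the parallel to $IB_1$ through $A$ with the line $OB_1$. The opposite $-A$ is the point of $\ell^{OI}$ with $A+(-A)=O$; $A-C$ means $A+(-C)$; for $A\ne O$, $A^{-1}$ is the point of $\ell^{OI}$ with $A\cdot A^{-1}=I$.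 For $A,B,C\in\ell^{OI}$, not all three equal, define the ratio $$r(A,B;C)=(B-C)^{-1}\cdot(A-C)\in\ell^{OI}\quad\text{if } B\ne C,\qquad r(A,B;C)=\infty\quad\text{if } B=C\ne A,$$ where $\infty$ is an additional infinite point, and put $O^{-1}=\infty$, $\infty^{-1}=O$. Then for all $A,B,C\in\ell^{OI}$ that are not all three equal, $$r(-A,-B;-C)=r(A,B;C)\qquad\text{and}\qquad r(A,B;C)^{-1}=r(B,A;C).$$ In particular the first identity holds between points of $\ell^{OI}$ whenever $B\neq C$, and the second whenever $A\ne C$ and $B\neq C$. -/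

import Mathlib

/-- An affine plane on a set `P` of points: lines are sets of points, two distinct points lie on
exactly one line, Playfair's axiom holds, and there are three non-collinear points. -/
structure AffinePlane (P : Type*) where
  lines : Set (Set P)
  existsUnique_line : ∀ X Y : P, X ≠ Y → ∃! l : Set P, l ∈ lines ∧ X ∈ l ∧ Y ∈ l
  playfair : ∀ (X : P) (l : Set P), l ∈ lines → X ∉ l →
    ∃! m : Set P, m ∈ lines ∧ X ∈ m ∧ l ∩ m = ∅
  exists_triangle : ∃ X Y Z : P, ∀ l ∈ lines, ¬ (X ∈ l ∧ Y ∈ l ∧ Z ∈ l)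

/-- Two lines are parallel if they are equal or disjoint. -/
def ParallelLines {P : Type*} (l m : Set P) : Prop := l = m ∨ l ∩ m = ∅

/-- A Desargues affine plane. In the Desargues axiom, `A, A' ∈ a`, `B, B' ∈ b`, `C, C' ∈ c` for
three distinct lines that are parallel or have a common point; `lAB` is the line `AB`, etc. -/
structure DesarguesPlane (P : Type*) extends AffinePlane P where
  desargues : ∀ A B C A' B' C' : P, ∀ a ∈ lines, ∀ b ∈ lines, ∀ c ∈ lines,
    A ∈ a → A' ∈ a → B ∈ b → B' ∈ b → C ∈ c → C' ∈ c →
    a ≠ b → b ≠ c → a ≠ c → A ≠ A' → B ≠ B' → C ≠ C' →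
    ((ParallelLines a b ∧ ParallelLines b c ∧ ParallelLines a c) ∨
      ∃ S : P, S ∈ a ∧ S ∈ b ∧ S ∈ c) →
    A ≠ B → A' ≠ B' → B ≠ C → B' ≠ C' → A ≠ C → A' ≠ C' →
    ∀ lAB ∈ lines, ∀ lAB' ∈ lines, ∀ lBC ∈ lines, ∀ lBC' ∈ lines,
    ∀ lAC ∈ lines, ∀ lAC' ∈ lines,
    A ∈ lAB → B ∈ lAB → A' ∈ lAB' → B' ∈ lAB' →
    B ∈ lBC → C ∈ lBC → B' ∈ lBC' → C' ∈ lBC' →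
    A ∈ lAC → C ∈ lAC → A' ∈ lAC' → C' ∈ lAC' →
    ParallelLines lAB lAB' → ParallelLines lBC lBC' → lAB ≠ lAB' → lBC ≠ lBC' →
    ParallelLines lAC lAC'

namespace AffinePlane

variable {P : Type*} (D : AffinePlane P)

/-- For `X ≠ Y`: the point `W` lies on the parallel through `Z` to the line `XY`. -/
def OnParallel (X Y Z W : P) : Prop :=
  ∃ l ∈ D.lines, ∃ m ∈ D.lines, X ∈ l ∧ Y ∈ l ∧ Z ∈ m ∧ W ∈ m ∧ ParallelLines l m

/-- For `X ≠ Y`: the point `Z` lies on the line `XY`. -/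
def OnLine (X Y Z : P) : Prop := ∃ l ∈ D.lines, X ∈ l ∧ Y ∈ l ∧ Z ∈ l

/-- `C` is obtained from the points `A`, `B` of the line `OI` by the addition construction, with
some auxiliary point `B₁` off the line `OI`. -/
def IsSum (O I A B C : P) : Prop :=
  D.OnLine O I C ∧ ∃ B₁ P₁ : P, ¬ D.OnLine O I B₁ ∧
    D.OnParallel O I B₁ P₁ ∧ D.OnParallel O B₁ A P₁ ∧ D.OnParallel B B₁ P₁ C

/-- `C` is obtained from the points `A`, `B` of the line `OI` by the multiplication construction,
with some auxiliary point `B₁` off the line `OI`. -/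
def IsProd (O I A B C : P) : Prop :=
  D.OnLine O I C ∧ ∃ B₁ P₁ : P, ¬ D.OnLine O I B₁ ∧
    D.OnParallel I B₁ A P₁ ∧ D.OnLine O B₁ P₁ ∧ D.OnParallel B B₁ P₁ C

theorem line_unique {X Y : P} (h : X ≠ Y) {l m : Set P} (hl : l ∈ D.lines) (hm : m ∈ D.lines)
    (hXl : X ∈ l) (hYl : Y ∈ l) (hXm : X ∈ m) (hYm : Y ∈ m) : l = m :=
  (D.existsUnique_line X Y h).unique ⟨hl, hXl, hYl⟩ ⟨hm, hXm, hYm⟩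

theorem _root_.ParallelLines.symm {l m : Set P} (h : ParallelLines l m) : ParallelLines m l := by
  rcases h with h | h
  · exact Or.inl h.symm
  · exact Or.inr (by rw [Set.inter_comm]; exact h)

theorem _root_.ParallelLines.eq_of_mem {l m : Set P} (h : ParallelLines l m) {X : P}
    (hl : X ∈ l) (hm : X ∈ m) : l = m := by
  rcases h with h | h
  · exact h
  · exact absurd (show X ∈ l ∩ m from ⟨hl, hm⟩) (by rw [h]; exact Set.notMem_empty X)

theorem parallel_trans {l m n : Set P} (hl : l ∈ D.lines) (hm : m ∈ D.lines) (hn : n ∈ D.lines)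
    (h : ParallelLines l m) (h' : ParallelLines m n) : ParallelLines l n := by
  by_cases hX : ∃ X, X ∈ l ∧ X ∈ n
  · obtain ⟨X, hXl, hXn⟩ := hX
    by_cases hXm : X ∈ m
    · exact Or.inl ((h.eq_of_mem hXl hXm).trans (h'.eq_of_mem hXm hXn))
    · refine Or.inl ((D.playfair X m hm hXm).unique ⟨hl, hXl, ?_⟩ ⟨hn, hXn, ?_⟩)
      · rcases h.symm with h | h
        · exact absurd (h ▸ hXl) hXm
        · exact h
      · rcases h' with h | h
        · exact absurd (h ▸ hXn) hXm
        · exact h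
  · refine Or.inr (Set.eq_empty_iff_forall_notMem.2 fun X hX' => hX ⟨X, hX'.1, hX'.2⟩)

theorem exists_parallel {l : Set P} (hl : l ∈ D.lines) (X : P) :
    ∃ m ∈ D.lines, X ∈ m ∧ ParallelLines l m := by
  by_cases hX : X ∈ l
  · exact ⟨l, hl, hX, Or.inl rfl⟩
  · obtain ⟨m, ⟨hm, hXm, h⟩, -⟩ := D.playfair X l hl hX
    exact ⟨m, hm, hXm, Or.inr h⟩

theorem exists_line {X Y : P} (h : X ≠ Y) : ∃ l ∈ D.lines, X ∈ l ∧ Y ∈ l := by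
  obtain ⟨l, ⟨hl, h1, h2⟩, -⟩ := D.existsUnique_line X Y h
  exact ⟨l, hl, h1, h2⟩

theorem exists_meet {l m : Set P} (h : ¬ ParallelLines l m) : ∃ X, X ∈ l ∧ X ∈ m := by
  by_contra hX
  exact h (Or.inr (Set.eq_empty_iff_forall_notMem.2 fun X hX' => hX ⟨X, hX'.1, hX'.2⟩))

theorem exists_notMem {l : Set P} (hl : l ∈ D.lines) : ∃ X, X ∉ l := by
  by_contra! h
  obtain ⟨X, Y, Z, hXYZ⟩ := D.exists_triangle
  exact hXYZ l hl ⟨h X, h Y, h Z⟩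

theorem onLine_iff {O I : P} (h : O ≠ I) {l : Set P} (hl : l ∈ D.lines) (hO : O ∈ l) (hI : I ∈ l)
    (X : P) : D.OnLine O I X ↔ X ∈ l := by
  constructor
  · rintro ⟨m, hm, h1, h2, h3⟩
    rwa [D.line_unique h hl hm hO hI h1 h2]
  · exact fun hX => ⟨l, hl, hO, hI, hX⟩

theorem exists_sumAux {O I : P} (h : O ≠ I) (A : P) {l : Set P} (hl : l ∈ D.lines) (hO : O ∈ l)
    (hI : I ∈ l) : ∃ B₁ P₁, B₁ ∉ l ∧ P₁ ∉ l ∧ ¬ D.OnLine O I B₁ ∧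
      D.OnParallel O I B₁ P₁ ∧ D.OnParallel O B₁ A P₁ := by
  obtain ⟨B₁, hB₁⟩ := D.exists_notMem hl
  obtain ⟨k, hk, hBk, hlk⟩ := D.exists_parallel hl B₁
  have hOB : O ≠ B₁ := fun e => hB₁ (e ▸ hO)
  obtain ⟨m, hm, hOm, hBm⟩ := D.exists_line hOB
  obtain ⟨m', hm', hAm', hmm'⟩ := D.exists_parallel hm A
  have hnp : ¬ ParallelLines k m' := fun hp => by
    have := D.parallel_trans hl hk hm hlk (D.parallel_trans hk hm' hm hp hmm'.symm)
    exact hB₁ (this.eq_of_mem hO hOm ▸ hBm)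
  obtain ⟨P₁, hPk, hPm⟩ := exists_meet hnp
  refine ⟨B₁, P₁, hB₁, fun hP => hB₁ ?_, (D.onLine_iff h hl hO hI B₁).not.2 hB₁,
    ⟨l, hl, k, hk, hO, hI, hBk, hPk, hlk⟩, ⟨m, hm, m', hm', hOm, hBm, hAm', hPm, hmm'⟩⟩
  rwa [hlk.eq_of_mem hP hPk]

theorem exists_prodAux {O I : P} (h : O ≠ I) {A : P} {l : Set P} (hl : l ∈ D.lines) (hO : O ∈ l)
    (hI : I ∈ l) (hA : A ∈ l) : ∃ B₁ P₁, B₁ ∉ l ∧ (A ≠ O → P₁ ∉ l) ∧ ¬ D.OnLine O I B₁ ∧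
      D.OnParallel I B₁ A P₁ ∧ D.OnLine O B₁ P₁ := by
  obtain ⟨B₁, hB₁⟩ := D.exists_notMem hl
  have hOB : O ≠ B₁ := fun e => hB₁ (e ▸ hO)
  have hIB : I ≠ B₁ := fun e => hB₁ (e ▸ hI)
  obtain ⟨m, hm, hOm, hBm⟩ := D.exists_line hOB
  obtain ⟨q, hq, hIq, hBq⟩ := D.exists_line hIB
  obtain ⟨q', hq', hAq', hqq'⟩ := D.exists_parallel hq A
  have hnp : ¬ ParallelLines q' m := fun hp => by
    have := (D.parallel_trans hq hq' hm hqq' hp).eq_of_mem hBq hBm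
    exact hB₁ (D.line_unique h hm hl hOm (this ▸ hIq) hO hI ▸ hBm)
  obtain ⟨P₁, hPq, hPm⟩ := exists_meet hnp
  refine ⟨B₁, P₁, hB₁, fun hAO hP => ?_, (D.onLine_iff h hl hO hI B₁).not.2 hB₁,
    ⟨q, hq, q', hq', hIq, hBq, hAq', hPq, hqq'⟩, ⟨m, hm, hOm, hBm, hPm⟩⟩
  have hPO : P₁ = O := by
    by_contra hne
    exact hB₁ (D.line_unique hne hm hl hPm hOm hP hO ▸ hBm)
  have hq'l : q' = l := D.line_unique hAO hq' hl hAq' (hPO ▸ hPq) hA hO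
  exact hB₁ (((hq'l ▸ hqq').eq_of_mem hIq hI : q = l) ▸ hBq)

theorem exists_last {l : Set P} (hl : l ∈ D.lines) {B B₁ : P} (hB : B ∈ l) (hB₁ : B₁ ∉ l)
    (P₁ : P) : ∃ C ∈ l, D.OnParallel B B₁ P₁ C := by
  obtain ⟨n, hn, hBn, hB₁n⟩ := D.exists_line (fun e => hB₁ (e ▸ hB) : B ≠ B₁)
  obtain ⟨n', hn', hPn', hnn'⟩ := D.exists_parallel hn P₁
  have hnp : ¬ ParallelLines n' l := fun hp =>
    hB₁ ((D.parallel_trans hn hn' hl hnn' hp).eq_of_mem hBn hB ▸ hB₁n)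
  obtain ⟨C, hCn, hCl⟩ := exists_meet hnp
  exact ⟨C, hCl, n, hn, n', hn', hBn, hB₁n, hPn', hCn, hnn'⟩

theorem OnParallel.swap {X Y Z W : P} (h : D.OnParallel X Y Z W) : D.OnParallel W Z Y X := by
  obtain ⟨l, hl, m, hm, h1, h2, h3, h4, h5⟩ := h
  exact ⟨m, hm, l, hl, h4, h3, h2, h1, h5.symm⟩

theorem exists_isSum {O I A B : P} (h : O ≠ I) (hB : D.OnLine O I B) :
    ∃ C, D.IsSum O I A B C := by
  obtain ⟨l, hl, hO, hI, hBl⟩ := hB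
  obtain ⟨B₁, P₁, h1, -, h2, h3, h4⟩ := D.exists_sumAux h A hl hO hI
  obtain ⟨C, hC, h5⟩ := D.exists_last hl hBl h1 P₁
  exact ⟨C, ⟨l, hl, hO, hI, hC⟩, B₁, P₁, h2, h3, h4, h5⟩

theorem exists_isProd {O I A B : P} (h : O ≠ I) (hA : D.OnLine O I A) (hB : D.OnLine O I B) :
    ∃ C, D.IsProd O I A B C := by
  obtain ⟨l, hl, hO, hI, hBl⟩ := hB
  obtain ⟨B₁, P₁, h1, -, h2, h3, h4⟩ :=
    D.exists_prodAux h hl hO hI ((D.onLine_iff h hl hO hI A).1 hA)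
  obtain ⟨C, hC, h5⟩ := D.exists_last hl hBl h1 P₁
  exact ⟨C, ⟨l, hl, hO, hI, hC⟩, B₁, P₁, h2, h3, h4, h5⟩

theorem exists_opposite {O I : P} (h : O ≠ I) (A : P) :
    ∃ X, D.OnLine O I X ∧ D.IsSum O I A X O := by
  obtain ⟨l, hl, hO, hI⟩ := D.exists_line h
  obtain ⟨B₁, P₁, -, h1, h2, h3, h4⟩ := D.exists_sumAux h A hl hO hI
  obtain ⟨X, hX, h5⟩ := D.exists_last hl hO h1 B₁
  exact ⟨X, ⟨l, hl, hO, hI, hX⟩, ⟨l, hl, hO, hI, hO⟩, B₁, P₁, h2, h3, h4, h5.swap⟩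

theorem exists_inverse {O I A : P} (h : O ≠ I) (hA : D.OnLine O I A) (hAO : A ≠ O) :
    ∃ X, D.OnLine O I X ∧ D.IsProd O I A X I := by
  obtain ⟨l, hl, hO, hI, hAl⟩ := hA
  obtain ⟨B₁, P₁, -, h1, h2, h3, h4⟩ := D.exists_prodAux h hl hO hI hAl
  obtain ⟨X, hX, h5⟩ := D.exists_last hl hI (h1 hAO) B₁
  exact ⟨X, ⟨l, hl, hO, hI, hX⟩, ⟨l, hl, hO, hI, hI⟩, B₁, P₁, h2, h3, h4, h5.swap⟩

end AffinePlane

namespace DesarguesPlane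

/-- The points of the line `OI`, for two distinct points `O`, `I` of the plane. -/
def LinePt {P : Type*} (D : DesarguesPlane P) {O I : P} (_hOI : O ≠ I) : Type _ :=
  {X : P // D.OnLine O I X}

namespace LinePt

variable {P : Type*} {D : DesarguesPlane P} {O I : P} {hOI : O ≠ I}

/-- The point `O`, as a point of the line `OI`. -/
instance : Zero (D.LinePt hOI) where
  zero := ⟨O, by
    obtain ⟨l, hl, hO, hI⟩ := D.exists_line hOI
    exact ⟨l, hl, hO, hI, hO⟩⟩

/-- The sum of two points of the line `OI`: the result of the addition construction, for some
choice of the auxiliary point. -/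
noncomputable instance : Add (D.LinePt hOI) where
  add A B :=
    ⟨(D.exists_isSum (A := A.1) hOI B.2).choose, (D.exists_isSum hOI B.2).choose_spec.1⟩

/-- The product of two points of the line `OI`: the result of the multiplication construction, for
some choice of the auxiliary point. -/
noncomputable instance : Mul (D.LinePt hOI) where
  mul A B :=
    ⟨(D.exists_isProd hOI A.2 B.2).choose, (D.exists_isProd hOI A.2 B.2).choose_spec.1⟩

/-- The opposite point: a point `X` of the line `OI` such that `A + X` is `O`. -/
noncomputable instance : Neg (D.LinePt hOI) where
  neg A := ⟨(D.exists_opposite hOI A.1).choose, (D.exists_opposite hOI A.1).choose_spec.1⟩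

/-- `A - C` is `A + (-C)`. -/
noncomputable instance : Sub (D.LinePt hOI) where
  sub A C := A + (-C)

/-- The inverse of a point `A ≠ O`: a point `X` of the line `OI` such that `A * X` is `I`. -/
noncomputable def inv (A : D.LinePt hOI) (hA : A ≠ 0) : D.LinePt hOI :=
  ⟨(D.exists_inverse hOI A.2 (fun e => hA (Subtype.ext e))).choose,
    (D.exists_inverse hOI A.2 (fun e => hA (Subtype.ext e))).choose_spec.1⟩

open Classical in
/-- The three-point ratio `(B - C)⁻¹ (A - C)`, with values in the line `OI` together with an
infinite point `∞`; it is `∞` when `B - C` is `O` (and meaningless when `A`, `B`, `C` coincide). -/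
noncomputable def ratio (A B C : D.LinePt hOI) : OnePoint (D.LinePt hOI) :=
  if h : B - C = 0 then OnePoint.infty else OnePoint.some (inv (B - C) h * (A - C))

open Classical in
/-- Inversion on the line `OI` together with `∞`: the usual inverse of a point `X ≠ O`, while `O`
and `∞` are exchanged. -/
noncomputable def extInv : OnePoint (D.LinePt hOI) → OnePoint (D.LinePt hOI)
  | none => OnePoint.some 0
  | some X => if h : X = 0 then OnePoint.infty else OnePoint.some (inv X h)

end LinePt

end DesarguesPlane

/-! The operations on the line `OI` are values of dilations, that is, of maps sending each line into
a parallel one. Such a map is determined by its values at two distinct points. Desargues' axiom,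
applied to a pencil of parallel or concurrent lines, produces enough of them
(`IsPencil.exists_dilation`): a translation taking any point to any other, and for each `A` on `OI`
a dilation `f_A` fixing `O` and sending `I` to `A`.

Translations make the whole plane an abelian group with zero `O` (`exists_addCommGroup`). Geometric
addition is its restriction to `OI` (`IsSum.eq_add`), and `A * B = f_A B` (`IsProd.eq_apply`). Both
hold for every auxiliary point, so the chosen one never matters.

The skew field axioms are not needed. For `A ≠ O` the map `f_A` is bijective and `A⁻¹ * B = f_A⁻¹
B`. Negation is a dilation and `f_A` is additive, so `f_A ∘ (-·)` is the dilation of `-A`, whence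
`(-A)⁻¹ * (-B) = A⁻¹ * B`: the first identity. The dilation of `A⁻¹ * B` is `f_A⁻¹ ∘ f_B`, with
inverse `f_B⁻¹ ∘ f_A`, whence `(A⁻¹ * B)⁻¹ = B⁻¹ * A`: the second. The values `O` and `∞` follow
from the conventions. -/

namespace AffinePlane

variable {P : Type*} {D : AffinePlane P}

/-! ### Parallelism between pairs of points -/

theorem OnParallel.symm {X Y Z W : P} (h : D.OnParallel X Y Z W) : D.OnParallel Z W X Y := by
  obtain ⟨l, hl, m, hm, h1, h2, h3, h4, h5⟩ := h
  exact ⟨m, hm, l, hl, h3, h4, h1, h2, h5.symm⟩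

theorem OnParallel.comm_left {X Y Z W : P} (h : D.OnParallel X Y Z W) :
    D.OnParallel Y X Z W := by
  obtain ⟨l, hl, m, hm, h1, h2, h3, h4, h5⟩ := h
  exact ⟨l, hl, m, hm, h2, h1, h3, h4, h5⟩

theorem OnParallel.comm_right {X Y Z W : P} (h : D.OnParallel X Y Z W) :
    D.OnParallel X Y W Z :=
  h.symm.comm_left.symm

theorem OnParallel.flip {X Y Z W : P} (h : D.OnParallel X Y Z W) : D.OnParallel Y X W Z :=
  h.comm_left.comm_right

/-- The middle pair must span a line: a pair of equal points is parallel to every pair. -/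
theorem OnParallel.trans {X Y Z W U V : P} (h : D.OnParallel X Y Z W)
    (h' : D.OnParallel Z W U V) (hne : Z ≠ W) : D.OnParallel X Y U V := by
  obtain ⟨l, hl, m, hm, h1, h2, h3, h4, h5⟩ := h
  obtain ⟨m', hm', n, hn, h3', h4', h6, h7, h8⟩ := h'
  obtain rfl := D.line_unique hne hm hm' h3 h4 h3' h4'
  exact ⟨l, hl, n, hn, h1, h2, h6, h7, D.parallel_trans hl hm hn h5 h8⟩

theorem onParallel_of_mem {l : Set P} (hl : l ∈ D.lines) {X Y Z W : P} (hX : X ∈ l) (hY : Y ∈ l)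
    (hZ : Z ∈ l) (hW : W ∈ l) : D.OnParallel X Y Z W :=
  ⟨l, hl, l, hl, hX, hY, hZ, hW, Or.inl rfl⟩

/-- The last point of a parallelism lies on every line in the right direction. -/
theorem OnParallel.mem {X Y Z W : P} (h : D.OnParallel X Y Z W) (hne : X ≠ Y) {l m : Set P}
    (hl : l ∈ D.lines) (hm : m ∈ D.lines) (hX : X ∈ l) (hY : Y ∈ l) (hZ : Z ∈ m)
    (hlm : ParallelLines l m) : W ∈ m := by
  obtain ⟨l', hl', m', hm', h1, h2, h3, h4, h5⟩ := h
  obtain rfl := D.line_unique hne hl hl' hX hY h1 h2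
  rwa [(D.parallel_trans hm hl hm' hlm.symm h5).eq_of_mem hZ h3]

/-- The last point of a parallelism to a line through its third point lies on that line. -/
theorem OnParallel.mem_self {X Y Z W : P} (h : D.OnParallel X Y Z W) (hne : X ≠ Y) {l : Set P}
    (hl : l ∈ D.lines) (hX : X ∈ l) (hY : Y ∈ l) (hZ : Z ∈ l) : W ∈ l :=
  h.mem hne hl hl hX hY hZ (Or.inl rfl)

/-- Three points that do not lie on a common line. -/
def Noncollinear (D : AffinePlane P) (X Y Z : P) : Prop :=
  ∀ l ∈ D.lines, ¬ (X ∈ l ∧ Y ∈ l ∧ Z ∈ l)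

theorem exists_line_through [Nontrivial P] (D : AffinePlane P) (X : P) :
    ∃ l ∈ D.lines, X ∈ l := by
  obtain ⟨Y, hY⟩ := exists_ne X
  obtain ⟨l, hl, hX, -⟩ := D.exists_line hY.symm
  exact ⟨l, hl, hX⟩

theorem Noncollinear.ne [Nontrivial P] {X Y Z : P} (h : D.Noncollinear X Y Z) : X ≠ Y := by
  rintro rfl
  by_cases hXZ : X = Z
  · obtain ⟨l, hl, hX⟩ := D.exists_line_through X
    exact h l hl ⟨hX, hX, hXZ ▸ hX⟩
  · obtain ⟨l, hl, hX, hZ⟩ := D.exists_line hXZ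
    exact h l hl ⟨hX, hX, hZ⟩

theorem Noncollinear.rotate {X Y Z : P} (h : D.Noncollinear X Y Z) : D.Noncollinear Y Z X :=
  fun l hl hh => h l hl ⟨hh.2.2, hh.1, hh.2.1⟩

theorem Noncollinear.swap {X Y Z : P} (h : D.Noncollinear X Y Z) : D.Noncollinear Y X Z :=
  fun l hl hh => h l hl ⟨hh.2.1, hh.1, hh.2.2⟩

theorem noncollinear_of_notMem {l : Set P} (hl : l ∈ D.lines) {X Y Z : P} (hne : X ≠ Y)
    (hX : X ∈ l) (hY : Y ∈ l) (hZ : Z ∉ l) : D.Noncollinear X Y Z := fun _ hm h =>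
  hZ (D.line_unique hne hm hl h.1 h.2.1 hX hY ▸ h.2.2)

theorem exists_noncollinear {X Y : P} (h : X ≠ Y) : ∃ Z, D.Noncollinear X Y Z := by
  obtain ⟨l, hl, hX, hY⟩ := D.exists_line h
  obtain ⟨Z, hZ⟩ := D.exists_notMem hl
  exact ⟨Z, noncollinear_of_notMem hl h hX hY hZ⟩

theorem onParallel_self [Nontrivial P] (D : AffinePlane P) (X Y : P) : D.OnParallel X Y X Y := by
  by_cases h : X = Y
  · obtain ⟨l, hl, hX⟩ := D.exists_line_through X
    exact onParallel_of_mem hl hX (h ▸ hX) hX (h ▸ hX)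
  · obtain ⟨l, hl, hX, hY⟩ := D.exists_line h
    exact onParallel_of_mem hl hX hY hX hY

theorem onParallel_of_eq_right [Nontrivial P] (D : AffinePlane P) (X Y Z : P) :
    D.OnParallel X Y Z Z := by
  obtain ⟨l, hl, -, -, h1, h2, -⟩ := D.onParallel_self X Y
  obtain ⟨n, hn, hZ, hln⟩ := D.exists_parallel hl Z
  exact ⟨l, hl, n, hn, h1, h2, hZ, hZ, hln⟩

/-- Parallels in two different directions meet at most once. -/
theorem eq_of_onParallel [Nontrivial P] {X Y Z U V W W' : P} (h : D.Noncollinear Z X Y)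
    (h1 : D.OnParallel Z X U W) (h1' : D.OnParallel Z X U W')
    (h2 : D.OnParallel Z Y V W) (h2' : D.OnParallel Z Y V W') : W = W' := by
  have hZX : Z ≠ X := h.ne
  have hZY : Z ≠ Y := h.rotate.rotate.swap.ne
  obtain ⟨l, hl, l', hl', hZl, hXl, hUl, hWl, hll⟩ := h1
  obtain ⟨m, hm, m', hm', hZm, hYm, hVm, hWm, hmm⟩ := h2
  have hWl' := h1'.mem hZX hl hl' hZl hXl hUl hll
  have hWm' := h2'.mem hZY hm hm' hZm hYm hVm hmm
  by_contra hne
  obtain rfl := D.line_unique hne hl' hm' hWl hWl' hWm hWm'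
  obtain rfl := (D.parallel_trans hl hl' hm hll hmm.symm).eq_of_mem hZl hZm
  exact h l hl ⟨hZl, hXl, hYm⟩

/-- A parallel to a line that crosses `l` meets `l` at most once. -/
theorem eq_of_mem_of_onParallel {l : Set P} (hl : l ∈ D.lines) {X Y U W W' : P} (hX : X ∈ l)
    (hY : Y ∉ l) (hW : W ∈ l) (hW' : W' ∈ l) (h : D.OnParallel X Y U W)
    (h' : D.OnParallel X Y U W') : W = W' := by
  have hXY : X ≠ Y := fun e => hY (e ▸ hX)
  obtain ⟨m, hm, m', hm', hXm, hYm, hUm, hWm, hmm⟩ := h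
  have hWm' := h'.mem hXY hm hm' hXm hYm hUm hmm
  by_contra hne
  obtain rfl := D.line_unique hne hl hm' hW hW' hWm hWm'
  obtain rfl := hmm.eq_of_mem hXm hX
  exact hY hYm

/-- The parallel through `U` to a line that crosses `l` meets `l`. -/
theorem exists_mem_onParallel {l : Set P} (hl : l ∈ D.lines) {X Y : P} (hX : X ∈ l)
    (hY : Y ∉ l) (U : P) : ∃ W ∈ l, D.OnParallel X Y U W :=
  D.exists_last hl hX hY U

/-! ### Dilations -/

/-- A map that sends each line into a parallel line. Constant maps are allowed. -/
def IsDilation (D : AffinePlane P) (f : P → P) : Prop :=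
  ∀ X Y, D.OnParallel X Y (f X) (f Y)

theorem isDilation_id [Nontrivial P] (D : AffinePlane P) : D.IsDilation id := D.onParallel_self

namespace IsDilation

variable {f g : P → P}

/-- The images of two vertices of a triangle fix that of the third, as the intersection of two
parallels. Points of the line `XY` are reached through an auxiliary point `W` off it. -/
theorem ext [Nontrivial P] (hf : D.IsDilation f) (hg : D.IsDilation g) {X Y : P} (hXY : X ≠ Y)
    (hX : f X = g X) (hY : f Y = g Y) : f = g := by
  have key : ∀ {X Y Z : P}, D.Noncollinear X Y Z → f X = g X → f Y = g Y → f Z = g Z := by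
    intro X Y Z h hX hY
    exact eq_of_onParallel h.rotate.rotate (hf X Z).comm_left (hX ▸ (hg X Z).comm_left)
      (hf Y Z).comm_left (hY ▸ (hg Y Z).comm_left)
  obtain ⟨W, hW⟩ := D.exists_noncollinear hXY
  have hfW := key hW hX hY
  funext Z
  by_cases hXZ : Z = X
  · rw [hXZ, hX]
  · by_cases hZ : D.Noncollinear X Y Z
    · exact key hZ hX hY
    · simp only [Noncollinear, not_forall, not_not] at hZ
      obtain ⟨l, hl, hXl, hYl, hZl⟩ := hZ
      have hWl : W ∉ l := fun hWl => hW l hl ⟨hXl, hYl, hWl⟩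
      exact key (noncollinear_of_notMem hl hXZ hZl hXl hWl).rotate hX hfW

theorem comp [Nontrivial P] (hf : D.IsDilation f) (hg : D.IsDilation g) :
    D.IsDilation (f ∘ g) := by
  intro X Y
  by_cases h : g X = g Y
  · simpa [h] using D.onParallel_of_eq_right X Y (f (g Y))
  · exact (hg X Y).trans (hf _ _) h

/-- Constant maps are dilations too, so uniqueness applies: a dilation is either constant or
injective. -/
theorem eq_const_of_eq [Nontrivial P] (hf : D.IsDilation f) {X Y : P} (hXY : X ≠ Y)
    (h : f X = f Y) : f = fun _ => f X :=
  hf.ext (fun U V => D.onParallel_of_eq_right U V (f X)) hXY rfl h.symm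

theorem injective_of_ne [Nontrivial P] (hf : D.IsDilation f) {X Y : P} (h : f X ≠ f Y) :
    Function.Injective f := by
  intro U V hUV
  by_contra hne
  have := hf.eq_const_of_eq hne hUV
  exact h ((congrFun this X).trans (congrFun this Y).symm)

theorem surjective [Nontrivial P] (hf : D.IsDilation f) (hinj : Function.Injective f) :
    Function.Surjective f := by
  intro Q
  obtain ⟨X⟩ : Nonempty P := ⟨Q⟩
  by_cases hXQ : f X = Q
  · exact ⟨X, hXQ⟩
  obtain ⟨a, ha, hXa, hQa⟩ := D.exists_line hXQ
  obtain ⟨n, hn, hXn, han⟩ := D.exists_parallel ha X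
  obtain ⟨Y, hY⟩ := D.exists_notMem hn
  have hfXY : f X ≠ f Y := fun e => hY (hinj e ▸ hXn)
  have hfYa : f Y ∉ a := fun h => hY ((hf X Y).symm.mem hfXY ha hn hXa h hXn han)
  have hYQ : f Y ≠ Q := fun e => hfYa (e ▸ hQa)
  obtain ⟨b, hb, hYb, hQb⟩ := D.exists_line hYQ
  obtain ⟨k, hk, hYk, hbk⟩ := D.exists_parallel hb Y
  have hnk : ¬ ParallelLines n k := fun hp => by
    obtain rfl := (D.parallel_trans ha hn hb han (D.parallel_trans hn hk hb hp hbk.symm)).eq_of_mem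
      hQa hQb
    exact hfYa hYb
  -- The lines `n` and `k` go into `a` and `b`, which meet only in `Q`, so `R` must go to `Q`.
  obtain ⟨R, hRn, hRk⟩ := exists_meet hnk
  refine ⟨R, by_contra fun hne => hfYa ?_⟩
  have h1 : f R ∈ a := by
    by_cases e : X = R
    · rwa [← e]
    · exact (hf X R).mem e hn ha hXn hRn hXa han.symm
  have h2 : f R ∈ b := by
    by_cases e : Y = R
    · rwa [← e]
    · exact (hf Y R).mem e hk hb hYk hRk hYb hbk.symm
  rwa [D.line_unique hne ha hb h1 hQa h2 hQb]

theorem symm {e : P ≃ P} (h : D.IsDilation e) : D.IsDilation e.symm := fun X Y => by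
  simpa using (h (e.symm X) (e.symm Y)).symm

end IsDilation

/-! ### Translations -/

/-- A dilation that is the identity or has no fixed point. -/
structure IsTranslation (D : AffinePlane P) (f : P → P) : Prop where
  isDilation : D.IsDilation f
  eq_id_of_fixed : ∀ X, f X = X → f = id

theorem isTranslation_id [Nontrivial P] (D : AffinePlane P) : D.IsTranslation id :=
  ⟨D.isDilation_id, fun _ _ => rfl⟩

namespace IsTranslation

variable {f g : P → P}

/-- The traces of a translation are parallel. -/
theorem trace [Nontrivial P] (hf : D.IsTranslation f) (X Y : P) :
    D.OnParallel X (f X) Y (f Y) := by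
  by_cases hX : f X = X
  · rw [hf.eq_id_of_fixed X hX]
    exact D.onParallel_of_eq_right X X Y
  by_cases hY : f Y = Y
  · exact absurd (by rw [hf.eq_id_of_fixed Y hY]; rfl) hX
  obtain ⟨u, hu, hXu, hfXu⟩ := D.exists_line (Ne.symm hX)
  obtain ⟨v, hv, hYv, hfYv⟩ := D.exists_line (Ne.symm hY)
  refine ⟨u, hu, v, hv, hXu, hfXu, hYv, hfYv, by_contra fun hnp => ?_⟩
  -- Both traces are invariant, so their common point would be fixed.
  obtain ⟨S, hSu, hSv⟩ := exists_meet hnp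
  have invariant : ∀ {Z : P} {w : Set P}, w ∈ D.lines → Z ∈ w → f Z ∈ w → S ∈ w → f S ∈ w := by
    intro Z w hw hZ hfZ hS
    by_cases e : Z = S
    · rwa [← e]
    · exact (hf.isDilation Z S).mem_self e hw hZ hS hfZ
  by_cases hS : f S = S
  · exact hX (by rw [hf.eq_id_of_fixed S hS]; rfl)
  · exact hnp (Or.inl (D.line_unique hS hu hv (invariant hu hXu hfXu hSu) hSu
      (invariant hv hYv hfYv hSv) hSv))

theorem injective [Nontrivial P] (hf : D.IsTranslation f) : Function.Injective f := by
  intro X Y h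
  by_contra hne
  have hc := hf.isDilation.eq_const_of_eq hne h
  -- A constant map fixes its value, hence would be the identity.
  have hid := hf.eq_id_of_fixed (f X) (congrFun hc (f X))
  exact hne (by simpa [hid] using h)

/-- Off the trace of `X`, the image of `Y` is cut out by the trace of `Y` and the parallel to `XY`
through `f X`. One value therefore determines a second, and so the map. -/
theorem ext [Nontrivial P] (hf : D.IsTranslation f) (hg : D.IsTranslation g) {X : P}
    (h : f X = g X) : f = g := by
  by_cases hX : f X = X
  · rw [hf.eq_id_of_fixed X hX, hg.eq_id_of_fixed X (h ▸ hX)]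
  obtain ⟨Y, hY⟩ := D.exists_noncollinear (Ne.symm hX)
  have hXY : X ≠ Y := hY.rotate.rotate.ne.symm
  refine hf.isDilation.ext hg.isDilation hXY h ?_
  exact eq_of_onParallel hY (hf.trace X Y) (h ▸ hg.trace X Y) (hf.isDilation X Y)
    (h ▸ hg.isDilation X Y)

/-- A translation, as a permutation of the points. -/
noncomputable def equiv [Nontrivial P] (hf : D.IsTranslation f) : P ≃ P :=
  Equiv.ofBijective f ⟨hf.injective, hf.isDilation.surjective hf.injective⟩

@[simp]
theorem coe_equiv [Nontrivial P] (hf : D.IsTranslation f) : ⇑hf.equiv = f := rfl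

theorem symm [Nontrivial P] (hf : D.IsTranslation f) : D.IsTranslation hf.equiv.symm := by
  refine ⟨IsDilation.symm hf.isDilation, fun X hX => ?_⟩
  have hid := hf.eq_id_of_fixed X ((hf.equiv.symm_apply_eq.1 hX).symm)
  funext Y
  rw [Equiv.symm_apply_eq, coe_equiv, hid]
  rfl

theorem comp [Nontrivial P] (hf : D.IsTranslation f) (hg : D.IsTranslation g) :
    D.IsTranslation (f ∘ g) := by
  refine ⟨hf.isDilation.comp hg.isDilation, fun X hX => ?_⟩
  -- If `f ∘ g` fixes `X`, then `g` agrees with the inverse of `f` at `X`, hence everywhere.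
  have : g = hf.equiv.symm := hg.ext hf.symm (X := X) ((Equiv.eq_symm_apply _).2 hX)
  funext Y
  rw [Function.comp_apply, this]
  exact hf.equiv.apply_symm_apply Y

theorem conj [Nontrivial P] (hf : D.IsTranslation f) {e : P ≃ P} (he : D.IsDilation e) :
    D.IsTranslation (e ∘ f ∘ e.symm) := by
  refine ⟨he.comp (hf.isDilation.comp he.symm), fun X hX => ?_⟩
  have hid := hf.eq_id_of_fixed (e.symm X) ((Equiv.eq_symm_apply _).2 hX)
  simp [hid]

end IsTranslation

/-! ### Pencils of lines and the dilations preserving them -/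

/-- A family of lines through a common set `S` of points (empty or a single point) that cover the
remaining points exactly once; `L X` is the line of the family through `X`. -/
structure IsPencil (D : AffinePlane P) (S : Set P) (L : P → Set P) : Prop where
  mem_lines : ∀ {X}, X ∉ S → L X ∈ D.lines
  self_mem : ∀ {X}, X ∉ S → X ∈ L X
  eq_of_mem : ∀ {X Y}, X ∉ S → Y ∉ S → Y ∈ L X → L Y = L X
  subset : ∀ {X}, X ∉ S → S ⊆ L X
  parallel_or_mem : (∀ {X Y}, X ∉ S → Y ∉ S → ParallelLines (L X) (L Y)) ∨ ∃ s, s ∈ S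

namespace IsPencil

variable {S : Set P} {L : P → Set P}

theorem notMem (h : D.IsPencil S L) {X Y : P} (hX : X ∉ S) (hY : Y ∉ S) (hne : L X ≠ L Y) :
    Y ∉ L X :=
  fun hm => hne (h.eq_of_mem hX hY hm).symm

theorem unique (h : D.IsPencil S L) {A A' X X₁ X₂ : P} (hA : A ∉ S) (hX : X ∉ S)
    (hne : L X ≠ L A) (h1 : X₁ ∈ L X) (h2 : X₂ ∈ L X) (hp1 : D.OnParallel A X A' X₁)
    (hp2 : D.OnParallel A X A' X₂) : X₁ = X₂ :=
  eq_of_mem_of_onParallel (h.mem_lines hX) (h.self_mem hX) (h.notMem hX hA hne) h1 h2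
    hp1.comm_left hp2.comm_left

theorem exists_image (h : D.IsPencil S L) {A A' X : P} (hA : A ∉ S) (hA' : A' ∉ S)
    (hX : X ∉ S) (hm : A' ∈ L A) (hne : L X ≠ L A) :
    ∃ X' ∉ S, X' ∈ L X ∧ D.OnParallel A X A' X' := by
  obtain ⟨W, hW, hp⟩ := exists_mem_onParallel (h.mem_lines hX) (h.self_mem hX)
    (h.notMem hX hA hne) A'
  refine ⟨W, fun hWS => ?_, hW, hp.comm_left⟩
  have hWA := h.subset hA hWS
  have hWA' : A' ≠ W := fun e => hA' (e ▸ hWS)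
  -- If `W` were in `S`, the line `A'W` would be `L A`, and its parallel through `A` would put `X`
  -- on `L A`.
  exact h.notMem hA hX hne.symm
    (hp.symm.comm_right.mem_self hWA' (h.mem_lines hA) hm hWA (h.self_mem hA))

theorem eq_of_fixed [Nontrivial P] (h : D.IsPencil S L) {A A' X X' : P} (hA : A ∉ S)
    (hX : X ∉ S) (hne : L X ≠ L A) (hX' : X' ∈ L X) (hAA' : A' = A)
    (hp : D.OnParallel A X A' X') : X' = X :=
  h.unique hA hX hne hX' (h.self_mem hX) hp (hAA' ▸ D.onParallel_self A' X)

theorem exists_ne (h : D.IsPencil S L) {X : P} (hX : X ∉ S) : ∃ Z ∉ S, L Z ≠ L X := by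
  obtain ⟨Z, hZ⟩ := D.exists_notMem (h.mem_lines hX)
  have hZS : Z ∉ S := fun hs => hZ (h.subset hX hs)
  exact ⟨Z, hZS, fun e => hZ (e ▸ h.self_mem hZS)⟩

/-- Desargues' axiom for a pencil, including the degenerate positions. -/
theorem desargues [Nontrivial P] {D : DesarguesPlane P} (h : D.IsPencil S L)
    {A B C A' B' C' : P} (hA : A ∉ S) (hB : B ∉ S) (hC : C ∉ S) (hA' : A' ∉ S) (hB' : B' ∉ S)
    (hC' : C' ∉ S) (hAA' : A' ∈ L A) (hBB' : B' ∈ L B) (hCC' : C' ∈ L C)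
    (hAB : L A ≠ L B) (hBC : L B ≠ L C) (hAC : L A ≠ L C)
    (h1 : D.OnParallel A B A' B') (h2 : D.OnParallel B C B' C') :
    D.OnParallel A C A' C' := by
  have ne_of : ∀ {X Y}, L X ≠ L Y → X ≠ Y := fun hne e => hne (e ▸ rfl)
  -- The axiom requires moved points. As soon as one of the three is fixed, all are.
  by_cases eA : A' = A
  · have eB := h.eq_of_fixed hA hB hAB.symm hBB' eA h1
    have eC := h.eq_of_fixed hB hC hBC.symm hCC' eB h2
    rw [eA, eC]
    exact D.onParallel_self A C
  have eB : B' ≠ B := fun e => eA (h.eq_of_fixed hB hA hAB hAA' e h1.flip)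
  have eC : C' ≠ C := fun e => eB (h.eq_of_fixed hC hB hBC hBB' e h2.flip)
  have lA := h.eq_of_mem hA hA' hAA'
  have lB := h.eq_of_mem hB hB' hBB'
  have lC := h.eq_of_mem hC hC' hCC'
  have hAB' : A' ≠ B' := ne_of (by rwa [lA, lB])
  have hBC' : B' ≠ C' := ne_of (by rwa [lB, lC])
  have hAC' : A' ≠ C' := ne_of (by rwa [lA, lC])
  -- The axiom also requires distinct sides: a common side would contain `X` and `X'`, hence be `L
  -- X`, and then contain `Y`.
  have lines_ne : ∀ {X X' Y : P} {l l' : Set P}, X ∉ S → Y ∉ S → L X ≠ L Y → X' ≠ X → X' ∈ L X →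
      l ∈ D.lines → X ∈ l → Y ∈ l → X' ∈ l' → l ≠ l' := by
    rintro X X' Y l l' hX hY hne hXX' hm hl hXl hYl hXl' rfl
    exact h.notMem hX hY hne
      (D.line_unique hXX' (h.mem_lines hX) hl hm (h.self_mem hX) hXl' hXl ▸ hYl)
  obtain ⟨l, hl, l', hl', hAl, hBl, hAl', hBl', hll⟩ := h1
  obtain ⟨m, hm, m', hm', hBm, hCm, hBm', hCm', hmm⟩ := h2
  obtain ⟨n, hn, hAn, hCn⟩ := D.exists_line (ne_of hAC)
  obtain ⟨n', hn', hAn', hCn'⟩ := D.exists_line hAC'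
  refine ⟨n, hn, n', hn', hAn, hCn, hAn', hCn', ?_⟩
  refine D.desargues A B C A' B' C' (L A) (h.mem_lines hA) (L B) (h.mem_lines hB) (L C)
    (h.mem_lines hC) (h.self_mem hA) hAA' (h.self_mem hB) hBB' (h.self_mem hC) hCC' hAB hBC hAC
    (Ne.symm eA) (Ne.symm eB) (Ne.symm eC) ?_ (ne_of hAB) hAB' (ne_of hBC) hBC' (ne_of hAC) hAC' l hl l' hl'
    m hm m' hm' n hn n' hn' hAl hBl hAl' hBl' hBm hCm hBm' hCm' hAn hCn hAn' hCn' hll hmm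
    (lines_ne hA hB hAB eA hAA' hl hAl hBl hAl') (lines_ne hB hC hBC eB hBB' hm hBm hCm hBm')
  rcases h.parallel_or_mem with hp | ⟨s, hs⟩
  · exact Or.inl ⟨hp hA hB, hp hB hC, hp hA hC⟩
  · exact Or.inr ⟨s, h.subset hA hs, h.subset hB hs, h.subset hC hs⟩

/-- If the pencil consists of two lines only, then the joins of moved points are parallel. -/
theorem onParallel_of_two_lines (h : D.IsPencil S L) {A B A' B' : P} (hA : A ∉ S) (hB : B ∉ S)
    (hA' : A' ∉ S) (hB' : B' ∉ S) (hAA' : A' ∈ L A) (hBB' : B' ∈ L B) (hne : L A ≠ L B)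
    (eA : A' ≠ A) (eB : B' ≠ B) (htwo : ∀ W ∉ S, L W = L A ∨ L W = L B) :
    D.OnParallel A B A' B' := by
  have lA := h.eq_of_mem hA hA' hAA'
  have lB := h.eq_of_mem hB hB' hBB'
  have hne' : L A' ≠ L B' := by rwa [lA, lB]
  obtain ⟨u, hu, hAu, hBu⟩ := D.exists_line (fun e => hne (e ▸ rfl) : A ≠ B)
  obtain ⟨v, hv, hAv, hBv⟩ := D.exists_line (fun e => hne' (e ▸ rfl) : A' ≠ B')
  refine ⟨u, hu, v, hv, hAu, hBu, hAv, hBv, by_contra fun hnp => ?_⟩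
  -- A common point `W` lies in `S` or on one of the two lines; there it coincides with a vertex
  -- outside `S`, or with both a point and its image.
  obtain ⟨W, hWu, hWv⟩ := exists_meet hnp
  have meet : ∀ {X Y : P} {w : Set P}, X ∉ S → Y ∉ S → L X ≠ L Y → w ∈ D.lines → X ∈ w → Y ∈ w →
      W ∈ w → W ∈ L X → W = X := by
    intro X Y w hX hY hXY hw hXw hYw hWw hWX
    by_contra e
    exact h.notMem hX hY hXY
      (D.line_unique e (h.mem_lines hX) hw hWX (h.self_mem hX) hWw hXw ▸ hYw)
  by_cases hW : W ∈ S
  · exact hA (meet hA hB hne hu hAu hBu hWu (h.subset hA hW) ▸ hW)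
  rcases htwo W hW with e | e
  · have hWA : W ∈ L A := e ▸ h.self_mem hW
    exact eA ((meet hA' hB' hne' hv hAv hBv hWv (lA ▸ hWA)).symm.trans
      (meet hA hB hne hu hAu hBu hWu hWA))
  · have hWB : W ∈ L B := e ▸ h.self_mem hW
    exact eB ((meet hB' hA' hne'.symm hv hBv hAv hWv (lB ▸ hWB)).symm.trans
      (meet hB hA hne.symm hu hBu hAu hWu hWB))

/-- In a Desargues plane there is a dilation that preserves the lines of a given pencil, with
prescribed image of one point. -/
theorem exists_dilation [Nontrivial P] {D : DesarguesPlane P} (h : D.IsPencil S L) {X Y : P}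
    (hX : X ∉ S) (hY : Y ∉ S) (hXY : Y ∈ L X) :
    ∃ f, D.IsDilation f ∧ f X = Y ∧ (∀ A ∈ S, f A = A) ∧ ∀ A ∉ S, f A ∈ L A := by
  by_cases hne : Y = X
  · exact ⟨id, D.isDilation_id, hne.symm, fun _ _ => rfl, fun _ hA => h.self_mem hA⟩
  obtain ⟨Z, hZ, hZX⟩ := h.exists_ne hX
  obtain ⟨Z', hZ', hZZ', hpZ⟩ := h.exists_image hX hY hZ hXY hZX
  -- Images off `L X` are drawn from the pair `X, Y`. On `L X` that construction degenerates, and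
  -- the auxiliary pair `Z, Z'` replaces it.
  have key : ∀ A, ∃ A', (A ∈ S → A' = A) ∧ (A ∉ S → A' ∉ S ∧ A' ∈ L A ∧
      (L A ≠ L X → D.OnParallel X A Y A') ∧ (L A = L X → D.OnParallel Z A Z' A')) := by
    intro A
    by_cases hA : A ∈ S
    · exact ⟨A, fun _ => rfl, fun hn => absurd hA hn⟩
    by_cases hAX : L A = L X
    · obtain ⟨A', h1, h2, h3⟩ := h.exists_image hZ hZ' hA hZZ' (hAX ▸ hZX.symm)
      exact ⟨A', fun hs => absurd hs hA, fun _ => ⟨h1, h2, fun hn => absurd hAX hn, fun _ => h3⟩⟩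
    · obtain ⟨A', h1, h2, h3⟩ := h.exists_image hX hY hA hXY hAX
      exact ⟨A', fun hs => absurd hs hA, fun _ => ⟨h1, h2, fun _ => h3, fun e => absurd e hAX⟩⟩
  choose f hfS hf using key
  have hfX : f X = Y := h.unique hZ hX hZX.symm (hf X hX).2.1 hXY ((hf X hX).2.2.2 rfl) hpZ.flip
  have hfZ : f Z = Z' := h.unique hX hZ hZX (hf Z hZ).2.1 hZZ' ((hf Z hZ).2.2.1 hZX) hpZ
  have off : ∀ {A B}, A ∉ S → B ∉ S → L A ≠ L X → L B ≠ L X → L A ≠ L B →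
      D.OnParallel A B (f A) (f B) := by
    intro A B hA hB hAX hBX hAB
    exact h.desargues hA hX hB (hf A hA).1 hY (hf B hB).1 (hf A hA).2.1 hXY (hf B hB).2.1
      hAX (Ne.symm hBX) hAB ((hf A hA).2.2.1 hAX).flip ((hf B hB).2.2.1 hBX)
  have on_off_ne : ∀ {A B}, A ∉ S → B ∉ S → L A = L X → L B ≠ L X → L B ≠ L Z →
      D.OnParallel A B (f A) (f B) := by
    intro A B hA hB hAX hBX hBZ
    exact h.desargues hA hZ hB (hf A hA).1 hZ' (hf B hB).1 (hf A hA).2.1 hZZ' (hf B hB).2.1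
      (hAX ▸ hZX.symm) (Ne.symm hBZ) (hAX ▸ hBX.symm) ((hf A hA).2.2.2 hAX).flip
      (hfZ ▸ off hZ hB hZX hBX (Ne.symm hBZ))
  have on_off : ∀ {A B}, A ∉ S → B ∉ S → L A = L X → L B ≠ L X →
      D.OnParallel A B (f A) (f B) := by
    intro A B hA hB hAX hBX
    by_cases hBZ : L B = L Z
    swap
    · exact on_off_ne hA hB hAX hBX hBZ
    have hAB : L A ≠ L B := hAX ▸ hBX.symm
    -- When `B` is on `L Z`, the vertex `Z` is unusable for Desargues; any third line of the pencil
    -- supplies another. If there is none, the pencil has only two lines.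
    by_cases hW : ∃ W ∉ S, L W ≠ L A ∧ L W ≠ L B
    · obtain ⟨W, hW, hWA, hWB⟩ := hW
      exact h.desargues hA hW hB (hf A hA).1 (hf W hW).1 (hf B hB).1 (hf A hA).2.1 (hf W hW).2.1
        (hf B hB).2.1 hWA.symm hWB hAB (on_off_ne hA hW hAX (hAX ▸ hWA) (hBZ ▸ hWB))
        (off hW hB (hAX ▸ hWA) hBX hWB)
    · have eZ : Z' ≠ Z := fun e => hne (h.eq_of_fixed hZ hX hZX.symm hXY e hpZ.flip)
      refine h.onParallel_of_two_lines hA hB (hf A hA).1 (hf B hB).1 (hf A hA).2.1 (hf B hB).2.1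
        hAB (fun e => eZ ?_) (fun e => hne ?_) fun W hWS => ?_
      · exact h.eq_of_fixed hA hZ (hAX ▸ hZX) hZZ' e ((hf A hA).2.2.2 hAX).flip
      · exact h.eq_of_fixed hB hX hBX.symm hXY e ((hf B hB).2.2.1 hBX).flip
      · by_contra! hn
        exact hW ⟨W, hWS, hn.1, hn.2⟩
  refine ⟨f, fun A B => ?_, hfX, hfS, fun A hA => (hf A hA).2.1⟩
  by_cases hA : A ∈ S
  · by_cases hB : B ∈ S
    · rw [hfS A hA, hfS B hB]
      exact D.onParallel_self A B
    · rw [hfS A hA]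
      exact onParallel_of_mem (h.mem_lines hB) (h.subset hB hA) (h.self_mem hB) (h.subset hB hA)
        (hf B hB).2.1
  by_cases hB : B ∈ S
  · rw [hfS B hB]
    exact onParallel_of_mem (h.mem_lines hA) (h.self_mem hA) (h.subset hA hB) (hf A hA).2.1
      (h.subset hA hB)
  by_cases hAB : L A = L B
  · exact onParallel_of_mem (h.mem_lines hA) (h.self_mem hA) (hAB ▸ h.self_mem hB) (hf A hA).2.1
      (hAB ▸ (hf B hB).2.1)
  by_cases hAX : L A = L X
  · exact on_off hA hB hAX (fun e => hAB (hAX.trans e.symm))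
  by_cases hBX : L B = L X
  · exact (on_off hB hA hBX hAX).flip
  · exact off hA hB hAX hBX hAB

end IsPencil

/-- The lines parallel to a given line form a pencil. -/
theorem exists_parallel_pencil {l : Set P} (hl : l ∈ D.lines) :
    ∃ L : P → Set P, D.IsPencil ∅ L ∧ ∀ X, ParallelLines l (L X) := by
  choose L hL hm hp using fun X => D.exists_parallel hl X
  have hpar : ∀ X Y, ParallelLines (L X) (L Y) := fun X Y =>
    D.parallel_trans (hL X) hl (hL Y) (hp X).symm (hp Y)
  exact ⟨L, ⟨fun _ => hL _, fun _ => hm _, fun _ _ h => (hpar _ _).eq_of_mem (hm _) h,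
    fun _ => Set.empty_subset _, Or.inl fun _ _ => hpar _ _⟩, hp⟩

/-- The lines through a given point form a pencil. -/
theorem exists_pencil_through (D : AffinePlane P) (O : P) :
    ∃ L : P → Set P, D.IsPencil {O} L := by
  have key : ∀ X, ∃ l, X ≠ O → l ∈ D.lines ∧ X ∈ l ∧ O ∈ l := fun X => by
    by_cases h : X = O
    · exact ⟨∅, fun hn => absurd h hn⟩
    · obtain ⟨l, hl⟩ := D.exists_line h
      exact ⟨l, fun _ => hl⟩
  choose L hL using key
  refine ⟨L, fun h => (hL _ h).1, fun h => (hL _ h).2.1, fun {X Y} hX hY h => ?_, ?_,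
    Or.inr ⟨O, rfl⟩⟩
  · exact D.line_unique hY (hL Y hY).1 (hL X hX).1 (hL Y hY).2.1 (hL Y hY).2.2 h (hL X hX).2.2
  · rintro X hX _ rfl
    exact (hL X hX).2.2

end AffinePlane

/-! ### The additive group of points, and homotheties -/

namespace DesarguesPlane

open AffinePlane

variable {P : Type*} [Nontrivial P]

theorem exists_translation (D : DesarguesPlane P) (A B : P) :
    ∃ f, D.IsTranslation f ∧ f A = B := by
  by_cases hAB : A = B
  · exact ⟨id, D.isTranslation_id, hAB⟩
  obtain ⟨l, hl, hA, hB⟩ := D.exists_line hAB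
  obtain ⟨L, hL, hp⟩ := exists_parallel_pencil hl
  have hBL : B ∈ L A := (hp A).eq_of_mem hA (hL.self_mem (Set.notMem_empty A)) ▸ hB
  obtain ⟨f, hf, hfA, -, hfL⟩ :=
    hL.exists_dilation (Set.notMem_empty A) (Set.notMem_empty B) hBL
  refine ⟨f, ⟨hf, fun X hX => ?_⟩, hfA⟩
  -- A fixed point forces the points on every other line of the parallel pencil to be fixed as well.
  obtain ⟨Y, -, hYX⟩ := hL.exists_ne (Set.notMem_empty X)
  have hXY : X ≠ Y := fun e => hYX (e ▸ rfl)
  exact hf.ext D.isDilation_id hXY hX (hL.eq_of_fixed (Set.notMem_empty X) (Set.notMem_empty Y)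
    hYX (hfL Y (Set.notMem_empty Y)) hX (hf X Y))

/-- The points of the plane, as an additive group with neutral element `O`: the sum `A + B` is the
image of `B` under the translation that sends `O` to `A`. -/
theorem exists_addCommGroup (D : DesarguesPlane P) (O : P) :
    ∃ _ : AddCommGroup P, (0 : P) = O ∧ ∀ A : P, D.IsTranslation (A + ·) := by
  choose t ht htO using D.exists_translation O
  have hext : ∀ {f A}, D.IsTranslation f → f O = A → f = t A := fun hf h =>
    hf.ext (ht _) (h.trans (htO _).symm)
  have hO : t O = id := (hext D.isTranslation_id rfl).symm
  have hassoc : ∀ A B C, t (t A B) C = t A (t B C) := fun A B C =>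
    (congrFun (hext ((ht A).comp (ht B)) (by simp [htO])) C).symm
  -- Both sums are the fourth vertex of the parallelogram on `O`, `A`, `B`.
  have comm_off : ∀ {A B}, D.Noncollinear O A B → t A B = t B A := fun {A B} h => by
    have h1 := (ht A).trace O B
    have h2 := (ht A).isDilation O B
    have h3 := (ht B).trace O A
    have h4 := (ht B).isDilation O A
    rw [htO] at h1 h2 h3 h4
    exact eq_of_onParallel h h1 h4 h2 h3
  have hcomm : ∀ A B, t A B = t B A := by
    intro A B
    by_cases hA : O = A
    · rw [← hA, hO, htO, id]
    by_cases hB : O = B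
    · rw [← hB, hO, htO, id]
    by_cases hAB : D.Noncollinear O A B
    · exact comm_off hAB
    simp only [Noncollinear, not_forall, not_not] at hAB
    obtain ⟨l, hl, hOl, hAl, hBl⟩ := hAB
    obtain ⟨C, hC⟩ := D.exists_notMem hl
    have hAC := comm_off (noncollinear_of_notMem hl hA hOl hAl hC)
    have hBC := comm_off (noncollinear_of_notMem hl hB hOl hBl hC)
    -- For collinear `A`, `B`, a point `C` off the line gives `(A + B) + C = (B + A) + C` by
    -- commuting only pairs not collinear with `O`.
    have hBC' : t B C ∉ l := fun hm => by
      have h := (ht B).trace O C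
      rw [htO] at h
      exact hC (h.comm_right.mem_self hB hl hOl hBl hm)
    have hABC := comm_off (noncollinear_of_notMem hl hA hOl hAl hBC')
    have : t (t A B) C = t (t B A) C := by
      rw [hassoc, hABC, hassoc, hassoc, hAC]
    have := (ht _).ext (ht _) this
    rw [← htO (t A B), this, htO]
  have hneg : ∀ A, ∃ B, t A B = O := fun A => (ht A).equiv.surjective O
  choose n hn using hneg
  let _ : Zero P := ⟨O⟩
  let _ : Add P := ⟨t⟩
  let _ : Neg P := ⟨n⟩
  refine ⟨{ add_assoc := hassoc, zero_add := congrFun hO, add_zero := htO, add_comm := hcomm,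
            neg_add_cancel := fun A => (hcomm _ _).trans (hn A),
            nsmul := nsmulRec, zsmul := zsmulRec }, rfl, ht⟩

theorem exists_homothety (D : DesarguesPlane P) {O I A : P} (hI : I ≠ O) (hA : D.OnLine O I A) :
    ∃ f, D.IsDilation f ∧ f O = O ∧ f I = A := by
  by_cases hAO : A = O
  -- For `A = O` the dilation is constant.
  · exact ⟨fun _ => O, fun U V => D.onParallel_of_eq_right U V O, rfl, hAO.symm⟩
  obtain ⟨L, hL⟩ := D.exists_pencil_through O
  obtain ⟨l, hl, hOl, hIl, hAl⟩ := hA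
  have : l = L I := D.line_unique hI hl (hL.mem_lines hI) hIl hOl (hL.self_mem hI)
    (hL.subset hI rfl)
  obtain ⟨f, hf, hfI, hfO, -⟩ := hL.exists_dilation (X := I) (Y := A) hI hAO (this ▸ hAl)
  exact ⟨f, hf, hfO O rfl, hfI⟩

end DesarguesPlane

/-! ### The geometric operations in terms of dilations -/

namespace AffinePlane

variable {P : Type*} {D : AffinePlane P}

section AddCommGroup

variable [AddCommGroup P]

theorem isDilation_neg (ht : ∀ A : P, D.IsTranslation (A + ·)) :
    D.IsDilation (fun A : P => -A) := fun X Y => by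
  -- Translation by `-X - Y` takes `Y` to `-X` and `X` to `-Y`.
  have h := (ht (-X - Y)).isDilation Y X
  have eX : -X - Y + Y = -X := by abel
  have eY : -X - Y + X = -Y := by abel
  simp only [eX, eY] at h
  exact h.comm_left

theorem IsDilation.map_add [Nontrivial P] (ht : ∀ A : P, D.IsTranslation (A + ·)) {f : P → P}
    (hf : D.IsDilation f) (hinj : Function.Injective f) (h0 : f 0 = 0) (A B : P) :
    f (A + B) = f A + f B := by
  obtain ⟨e, rfl⟩ : ∃ e : P ≃ P, f = e :=
    ⟨Equiv.ofBijective f ⟨hinj, hf.surjective hinj⟩, rfl⟩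
  -- Conjugating translation by `A` with `e` gives a translation sending `0` to `e A`, hence
  -- translation by `e A`.
  have h := ((ht A).conj hf).ext (ht (e A)) (X := 0)
    (by simp [(Equiv.symm_apply_eq e).2 h0.symm])
  simpa using congrFun h (e B)

theorem IsDilation.map_neg [Nontrivial P] (ht : ∀ A : P, D.IsTranslation (A + ·)) {f : P → P}
    (hf : D.IsDilation f) (hinj : Function.Injective f) (h0 : f 0 = 0) (A : P) :
    f (-A) = -f A :=
  eq_neg_of_add_eq_zero_left (by rw [← hf.map_add ht hinj h0, neg_add_cancel, h0])

theorem IsSum.eq_add [Nontrivial P] (ht : ∀ A : P, D.IsTranslation (A + ·)) {I A B C : P} (hI : 0 ≠ I)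
    (hA : D.OnLine 0 I A) (hB : D.OnLine 0 I B) (h : D.IsSum 0 I A B C) : C = A + B := by
  obtain ⟨hC, B₁, P₁, hB₁, h1, h2, h3⟩ := h
  obtain ⟨l, hl, hO, hIl, hAl⟩ := hA
  rw [D.onLine_iff hI hl hO hIl] at hB hC hB₁
  have trace : ∀ X, D.OnParallel 0 I X (A + X) := fun X => by
    by_cases hA0 : A = 0
    · simpa [hA0] using D.onParallel_of_eq_right 0 I X
    · have h := (ht A).trace 0 X
      rw [add_zero] at h
      exact (onParallel_of_mem hl hO hIl hO hAl).trans h (Ne.symm hA0)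
  have hP : P₁ = A + B₁ := by
    refine eq_of_onParallel (noncollinear_of_notMem hl hI hO hIl hB₁) h1 (trace B₁) h2 ?_
    simpa using (ht A).isDilation 0 B₁
  exact eq_of_mem_of_onParallel hl hB hB₁ hC ((trace B).mem_self hI hl hO hIl hB) h3
    (hP ▸ ((ht A).isDilation B B₁).comm_right)

end AddCommGroup

theorem IsProd.eq_apply {O I A B C : P} (hI : O ≠ I) (hA : D.OnLine O I A)
    (hB : D.OnLine O I B) {f : P → P} (hf : D.IsDilation f) (hO : f O = O) (hfI : f I = A)
    (h : D.IsProd O I A B C) : C = f B := by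
  obtain ⟨hC, B₁, P₁, hB₁, h1, h2, h3⟩ := h
  obtain ⟨l, hl, hOl, hIl, hAl⟩ := hA
  rw [D.onLine_iff hI hl hOl hIl] at hB hC hB₁
  have mem : ∀ {m X}, m ∈ D.lines → O ∈ m → X ∈ m → f X ∈ m := fun {m X} hm hOm hXm => by
    by_cases e : O = X
    · rwa [← e, hO]
    · exact (hf O X).mem_self e hm hOm hXm (hO.symm ▸ hOm)
  obtain ⟨m, hm, hOm, hBm, hPm⟩ := h2
  have hIm : I ∉ m := fun hIm => hB₁ (D.line_unique hI hm hl hOm hIm hOl hIl ▸ hBm)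
  -- Since `f` fixes `O`, it preserves the line `OB₁`; the parallel to `IB₁` through `A` then
  -- determines `f B₁`.
  have hP : P₁ = f B₁ := eq_of_mem_of_onParallel hm hBm hIm hPm (mem hm hOm hBm)
    h1.comm_left (hfI ▸ (hf I B₁).comm_left)
  exact eq_of_mem_of_onParallel hl hB hB₁ hC (mem hl hOl hB) h3 (hP ▸ (hf B B₁).comm_right)

end AffinePlane

/-! ### Inverses and ratios on the line -/

namespace DesarguesPlane.LinePt

open AffinePlane

variable {P : Type*} {D : DesarguesPlane P}

theorem coe_inj {O I : P} {hI : O ≠ I} {A B : D.LinePt hI} : A.1 = B.1 ↔ A = B :=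
  Subtype.ext_iff.symm

theorem coe_zero {O I : P} {hI : O ≠ I} : (0 : D.LinePt hI).1 = O := rfl

theorem coe_mul {O I : P} {hI : O ≠ I} {A : D.LinePt hI} {f : P → P} (hf : D.IsDilation f)
    (hO : f O = O) (hfI : f I = A.1) (B : D.LinePt hI) : (A * B).1 = f B.1 :=
  IsProd.eq_apply hI A.2 B.2 hf hO hfI (D.exists_isProd hI A.2 B.2).choose_spec

theorem injective_of_apply_one [Nontrivial P] {O I : P} {hI : O ≠ I} {A : D.LinePt hI} (hA : A ≠ 0)
    {f : P → P} (hf : D.IsDilation f) (hO : f O = O) (hfI : f I = A.1) : Function.Injective f :=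
  hf.injective_of_ne (X := I) (Y := O) (by
    rw [hO, hfI]
    exact fun e => hA (Subtype.ext e))

theorem apply_inv {O I : P} {hI : O ≠ I} {A : D.LinePt hI} (hA : A ≠ 0) {f : P → P}
    (hf : D.IsDilation f) (hO : f O = O) (hfI : f I = A.1) : f (inv A hA).1 = I :=
  (IsProd.eq_apply hI A.2 (inv A hA).2 hf hO hfI
    (D.exists_inverse hI A.2 (fun e => hA (Subtype.ext e))).choose_spec.2).symm

variable [Nontrivial P]

/-- The inverse of `f` is a dilation fixing `O` and sending `I` to `inv A hA`, so it computes left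
multiplication by that point. -/
theorem apply_inv_mul {O I : P} {hI : O ≠ I} {A : D.LinePt hI} (hA : A ≠ 0) {f : P → P}
    (hf : D.IsDilation f) (hO : f O = O) (hfI : f I = A.1) (B : D.LinePt hI) :
    f (inv A hA * B).1 = B.1 := by
  have hinv := apply_inv hA hf hO hfI
  have hinj := injective_of_apply_one hA hf hO hfI
  obtain ⟨e, rfl⟩ : ∃ e : P ≃ P, f = e :=
    ⟨Equiv.ofBijective f ⟨hinj, hf.surjective hinj⟩, rfl⟩
  rw [coe_mul hf.symm ((Equiv.symm_apply_eq e).2 hO.symm) ((Equiv.symm_apply_eq e).2 hinv.symm),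
    e.apply_symm_apply]

theorem exists_dilation {O I : P} {hI : O ≠ I} (A : D.LinePt hI) :
    ∃ f, D.IsDilation f ∧ f O = O ∧ f I = A.1 :=
  D.exists_homothety hI.symm A.2

theorem inv_mul_zero {O I : P} {hI : O ≠ I} {A : D.LinePt hI} (hA : A ≠ 0) :
    inv A hA * 0 = 0 := by
  obtain ⟨f, hf, hO, hfI⟩ := exists_dilation A
  exact Subtype.ext (injective_of_apply_one hA hf hO hfI
    ((apply_inv_mul hA hf hO hfI 0).trans hO.symm))

theorem inv_mul_ne_zero {O I : P} {hI : O ≠ I} {A B : D.LinePt hI} (hA : A ≠ 0) (hB : B ≠ 0) :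
    inv A hA * B ≠ 0 := fun h => hB (by
  obtain ⟨f, hf, hO, hfI⟩ := exists_dilation A
  have := apply_inv_mul hA hf hO hfI B
  rw [h] at this
  exact Subtype.ext (this.symm.trans hO))

theorem inv_inv_mul {O I : P} {hI : O ≠ I} {A B : D.LinePt hI} (hA : A ≠ 0) (hB : B ≠ 0) :
    inv (inv A hA * B) (inv_mul_ne_zero hA hB) = inv B hB * A := by
  obtain ⟨f, hf, hfO, hfI⟩ := exists_dilation A
  obtain ⟨g, hg, hgO, hgI⟩ := exists_dilation B
  have hfinj := injective_of_apply_one hA hf hfO hfI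
  have hfAB := apply_inv_mul hA hf hfO hfI B
  obtain ⟨e, rfl⟩ : ∃ e : P ≃ P, f = e :=
    ⟨Equiv.ofBijective f ⟨hfinj, hf.surjective hfinj⟩, rfl⟩
  -- The dilation of `inv A hA * B` is `e.symm ∘ g`, so `g` takes the inverse of this product to `e
  -- I = A`.
  have h := apply_inv (inv_mul_ne_zero hA hB) (hf.symm.comp hg)
    (by rw [Function.comp_apply, hgO, Equiv.symm_apply_eq, hfO])
    (by rw [Function.comp_apply, hgI, Equiv.symm_apply_eq, hfAB])
  rw [Function.comp_apply, Equiv.symm_apply_eq, hfI] at h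
  exact Subtype.ext (injective_of_apply_one hB hg hgO hgI
    (h.trans (apply_inv_mul hB hg hgO hgI A).symm))

section AddCommGroup

variable [AddCommGroup P] {I : P} {hI : 0 ≠ I}

theorem coe_add (ht : ∀ A : P, D.IsTranslation (A + ·)) (A B : D.LinePt hI) :
    (A + B).1 = A.1 + B.1 :=
  IsSum.eq_add ht hI A.2 B.2 (D.exists_isSum hI B.2).choose_spec

theorem coe_neg (ht : ∀ A : P, D.IsTranslation (A + ·)) (A : D.LinePt hI) :
    (-A).1 = -A.1 :=
  (neg_eq_of_add_eq_zero_right (IsSum.eq_add ht hI A.2 (-A).2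
    (D.exists_opposite hI A.1).choose_spec.2).symm).symm

theorem coe_sub (ht : ∀ A : P, D.IsTranslation (A + ·)) (A B : D.LinePt hI) :
    (A - B).1 = A.1 - B.1 := by
  rw [sub_eq_add_neg, ← coe_neg ht]
  exact coe_add ht A (-B)

theorem sub_eq_zero_iff (ht : ∀ A : P, D.IsTranslation (A + ·)) (A B : D.LinePt hI) :
    A - B = 0 ↔ A = B := by
  rw [← coe_inj, coe_sub ht, coe_zero, sub_eq_zero, coe_inj]

theorem neg_sub_neg_eq (ht : ∀ A : P, D.IsTranslation (A + ·)) (A B : D.LinePt hI) :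
    -A - -B = -(A - B) :=
  Subtype.ext (by rw [coe_sub ht, coe_neg ht, coe_neg ht, coe_neg ht, coe_sub ht]; abel)

theorem neg_eq_zero_iff (ht : ∀ A : P, D.IsTranslation (A + ·)) (A : D.LinePt hI) :
    -A = 0 ↔ A = 0 := by
  rw [← coe_inj, coe_neg ht, coe_zero, neg_eq_zero, ← coe_inj, coe_zero]

theorem inv_neg_mul_neg (ht : ∀ A : P, D.IsTranslation (A + ·)) {A : D.LinePt hI} (hA : A ≠ 0)
    (hA' : -A ≠ 0) (B : D.LinePt hI) : inv (-A) hA' * -B = inv A hA * B := by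
  obtain ⟨f, hf, hO, hfI⟩ := exists_dilation A
  have hinj := injective_of_apply_one hA hf hO hfI
  -- By additivity of `f`, its composite with negation sends `I` to `-A`.
  have h := apply_inv_mul hA' (hf.comp (isDilation_neg ht)) (by simp [hO])
    (by simp [hf.map_neg ht hinj hO, hfI, coe_neg ht]) (-B)
  rw [Function.comp_apply, hf.map_neg ht hinj hO, coe_neg ht, neg_inj] at h
  exact Subtype.ext (hinj (h.trans (apply_inv_mul hA hf hO hfI B).symm))

theorem ratio_neg (ht : ∀ A : P, D.IsTranslation (A + ·)) (A B C : D.LinePt hI) :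
    ratio (-A) (-B) (-C) = ratio A B C := by
  unfold ratio
  rw [neg_sub_neg_eq ht, neg_sub_neg_eq ht]
  by_cases h : B - C = 0
  · rw [dif_pos h, dif_pos ((neg_eq_zero_iff ht _).2 h)]
  · rw [dif_neg h, dif_neg ((neg_eq_zero_iff ht _).not.2 h), inv_neg_mul_neg ht h]

theorem extInv_ratio (ht : ∀ A : P, D.IsTranslation (A + ·)) {A B C : D.LinePt hI}
    (hABC : A ≠ C ∨ B ≠ C) : extInv (ratio A B C) = ratio B A C := by
  unfold ratio
  by_cases hB : B - C = 0
  -- Here the hypothesis is essential: for `A = B = C` both ratios are `∞`, while `extInv` takes `∞`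
  -- to `0`.
  · have hA : A - C ≠ 0 := by
      rw [Ne, sub_eq_zero_iff ht]
      exact hABC.resolve_right (not_not.2 ((sub_eq_zero_iff ht _ _).1 hB))
    rw [dif_pos hB, dif_neg hA, hB, inv_mul_zero]
    rfl
  rw [dif_neg hB]
  by_cases hA : A - C = 0
  · rw [dif_pos hA, hA, inv_mul_zero]
    exact dif_pos rfl
  · rw [dif_neg hA, ← inv_inv_mul hB hA]
    exact dif_neg (inv_mul_ne_zero hB hA)

end AddCommGroup

end DesarguesPlane.LinePt

theorem mainTheorem6 {P : Type*} (D : DesarguesPlane P) (O I : P) (hOI : O ≠ I)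
    (A B C : D.LinePt hOI) (hABC : A ≠ C ∨ B ≠ C) :
    DesarguesPlane.LinePt.ratio (-A) (-B) (-C) = DesarguesPlane.LinePt.ratio A B C ∧
      DesarguesPlane.LinePt.extInv (DesarguesPlane.LinePt.ratio A B C) =
        DesarguesPlane.LinePt.ratio B A C := by
  have : Nontrivial P := ⟨O, I, hOI⟩
  -- From here on `O` is the zero of the group.
  obtain ⟨_, rfl, ht⟩ := D.exists_addCommGroup O
  exact ⟨DesarguesPlane.LinePt.ratio_neg ht A B C, DesarguesPlane.LinePt.extInv_ratio ht hABC⟩
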